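/- All graphs are finite and simple. A *3-tree* is a graph $G$ for which there is a sequence $G_0, G_1, \dots, G_s$ ($s \ge 0$) of induced subgraphs of $G$ such that $G_0$ is isomorphic to $K_4$, $G_s = G$, and for every $i$ with $1 \le i \le s$ there is a vertex $v \in V(G_i)\setminus V(G_{i-1})$ such that $V(G_i) = V(G_{i-1}) \cup \{v\}$ and $N_G(v)\cap V(G_{i-1})$ is a clique of order $3$ of $G$. For a positive integer $m$, a graph $G$ is *odd $m$-colorable* if there is a map $\varphi : V(G) \to \{1,\dots,m\}$ with $\varphi(u)\ne\varphi(v)$ for every edge $uv$ such that for every non-isolated vertex $v$ of $G$ there is a color $i$ for which $|\varphi^{-1}(i)\cap N_G(v)|$ is odd. **Theorem.** Every 3-tree is odd $5$-colorable. This is tight: there exists a 3-tree that is not odd $4$-colorable. -/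

import Mathlib

/-- `G` is a `k`-tree, witnessed by an addition sequence. `W 0, W 1, …, W s` are the vertex sets of
the induced subgraphs `G₀, G₁, …, G_s`: the first one induces a complete graph on `k + 1` vertices,
the last one is all of `G`, and each `W (i + 1)` is `W i` together with one new vertex `v` whose
neighbours inside `W i` form a clique of order `k`. -/
def IsKTree {V : Type*} [Finite V] (k : ℕ) (G : SimpleGraph V) : Prop :=
  ∃ (s : ℕ) (W : ℕ → Set V),
    (G.IsClique (W 0) ∧ (W 0).ncard = k + 1) ∧
    W s = Set.univ ∧
    ∀ i < s, ∃ v, v ∉ W i ∧ W (i + 1) = insert v (W i) ∧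
      G.IsClique (G.neighborSet v ∩ W i) ∧ (G.neighborSet v ∩ W i).ncard = k

/-- The vertex `v` satisfies the odd condition with respect to the proper coloring `φ`: some color
appears on an odd number of neighbours of `v`. -/
def SatisfiesOddCondition {V : Type*} [Finite V] {G : SimpleGraph V} {m : ℕ}
    (φ : G.Coloring (Fin m)) (v : V) : Prop :=
  ∃ i : Fin m, Odd {w | w ∈ G.neighborSet v ∧ φ w = i}.ncard

/-- `G` admits an odd `m`-coloring: a proper coloring with `m` colors such that every non-isolated
vertex satisfies the odd condition. -/
def OddColorable {V : Type*} [Finite V] (G : SimpleGraph V) (m : ℕ) : Prop :=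
  ∃ φ : G.Coloring (Fin m), ∀ v, (G.neighborSet v).Nonempty → SatisfiesOddCondition φ v

/-! A vertex satisfies the odd condition exactly when the vector over `ZMod 2` counting its
neighbours of each colour is nonzero. Whatever is stacked later over a triangle affects earlier
vertices only through the parities it adds at the three corners, so it can be summarised by a set of
available outcomes. Such a set is `Good` if, for any one forbidden vector per corner, some outcome
avoids all three (`NoHit`), or if it contains a set from the finite list `stdTypes`.

Good sets are closed under sums (`Good.add`) and under stacking a vertex with good sets on the new
faces (`good_stack`). One `NoHit` ingredient makes the result `NoHit`, since its outcome can be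
chosen last; the remaining combinations of standard sets are finitely many and are checked on bit
codes.

`Solvable` quantifies over all good assignments. Hence in `solvable_insert` the demands of the
larger graph are absorbed into the outcome set of one triangle of the smaller graph. The induction
starts at a single triangle, and assigning `{0}` everywhere at the end gives the colouring. For
tightness, four colours force the colouring of `hexagonCone` up to permutation. -/

/-!
A parity vector records, for each of the five colours, a parity. An outcome on a triangle assigns a
parity vector to each of its vertices, relative to a colouring of the triangle by `0, 1, 2`. Outcomes
are coded by natural numbers: bit `5 * i + m` is the parity of colour `m` at vertex `i`.

Stacking a vertex on a triangle with colours `0, 1, 2` gives it colour `3` or `4`, according to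
`k : Fin 2`. The new tetrahedron has three new faces; face `j` omits vertex `j` of the triangle.
-/

/-! ### Outcomes as bit codes, and the finite search -/

/-- Translation of the colours relative to face `j` into those relative to the old triangle. -/
def relabel (j : Fin 3) (k : Fin 2) : Fin 5 → Fin 5 :=
  match j, k with
  | 0, 0 => ![1, 2, 3, 0, 4]
  | 0, 1 => ![1, 2, 4, 0, 3]
  | 1, 0 => ![0, 2, 3, 1, 4]
  | 1, 1 => ![0, 2, 4, 1, 3]
  | 2, 0 => ![0, 1, 3, 2, 4]
  | 2, 1 => ![0, 1, 4, 2, 3]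

/-- Position in the tetrahedron of bit `5 * i + m` on face `j`. -/
def liftBit (j : Fin 3) (k : Fin 2) (i : Fin 3) (m : Fin 5) : ℕ :=
  5 * (j.castSucc.succAbove i : ℕ) + relabel j k m

/-- Code on the tetrahedron of an outcome on face `j`. -/
def liftCode (j : Fin 3) (k : Fin 2) (n : ℕ) : ℕ :=
  (List.finRange 3).foldr (fun (i : Fin 3) r => (List.finRange 5).foldr
    (fun (m : Fin 5) r =>
      (bif n.testBit (5 * (i : ℕ) + m) then 2 ^ liftBit j k i m else 0) ^^^ r) r) 0

/-- Parities in the tetrahedron due to the new vertex and its three neighbours. -/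
def baseCode (k : Fin 2) : ℕ := match k with
  | 0 => 2 ^ 3 + 2 ^ 8 + 2 ^ 13 + 7 * 2 ^ 15
  | 1 => 2 ^ 4 + 2 ^ 9 + 2 ^ 14 + 7 * 2 ^ 15

/-- The parity vector at vertex `i`, as a number below `32`. -/
def field (i n : ℕ) : ℕ := (n >>> (5 * i)) % 32

/-- Outcomes on a triangle obtained by stacking a vertex, with outcomes `t j` on the new face `j`,
such that the new vertex has a nonzero parity vector. -/
def compCode (t : Fin 3 → List ℕ) : List ℕ :=
  [0, 1].flatMap fun k =>
    ((t 0).map (liftCode 0 k)).flatMap fun a =>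
      ((t 1).map (liftCode 1 k)).flatMap fun b =>
        ((t 2).map (liftCode 2 k)).filterMap fun c =>
          let n := baseCode k ^^^ (a ^^^ (b ^^^ c))
          bif (field 3 n).beq 0 then none else some (n % 32768)

/-- Sums of two outcomes on the same triangle. -/
def sumCode (s t : List ℕ) : List ℕ := s.flatMap fun a => t.map fun b => a ^^^ b

/-- A search certifying that no choice of one parity vector per vertex in `r` meets every outcome;
the first argument bounds the depth. -/
def noHit : ℕ → List ℕ → List ℕ → Bool
  | 0, _, _ => false
  | _ + 1, _, [] => false
  | d + 1, r, h :: S => r.all fun j =>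
      noHit d (r.erase j) ((h :: S).filter fun x => !(field j x).beq (field j h))

/-- Outcome sets which, together with the unhittable ones, are closed under `sumCode` and `compCode`:
nothing, a stacked vertex, a stacked vertex with a further vertex on one of the three new faces, and
three outcomes of a larger configuration in its six orientations. -/
def stdTypes : List (List ℕ) :=
  [[0], [8456, 16912],
    [9512, 25352, 17968, 25360], [10506, 24856, 18962, 25112], [8588, 8984, 17044, 17176],
    [27530, 20274, 26296], [27532, 26292, 20280], [25916, 20026, 27414],
    [26012, 27286, 20250], [10042, 18108, 25494], [11066, 19350, 25276]]

/-- The outcome set is unhittable or contains a standard one. -/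
def goodCode (S : List ℕ) : Bool :=
  noHit 4 [0, 1, 2] S || stdTypes.any fun t => t.all fun x => S.any fun y => x.beq y

/-! ### Parity vectors and the algebra of stacking -/

abbrev ParityVec := Fin 5 → ZMod 2

/-- Transport of a parity vector along a map of colours. -/
def push (ρ : Fin 5 → Fin 5) : ParityVec →ₗ[ZMod 2] ParityVec :=
  Fintype.linearCombination (ZMod 2) fun m => Pi.single (ρ m) 1

theorem push_single (ρ : Fin 5 → Fin 5) (c : Fin 5) :
    push ρ (Pi.single c 1) = Pi.single (ρ c) 1 := by
  simp [push, Fintype.linearCombination_apply_single]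

theorem push_push (ρ σ : Fin 5 → Fin 5) (x : ParityVec) :
    push ρ (push σ x) = push (ρ ∘ σ) x := by
  simp only [push, Fintype.linearCombination_apply, map_sum, map_smul]
  refine Finset.sum_congr rfl fun m _ => ?_
  congr 1
  exact push_single ρ (σ m)

theorem push_apply {ρ : Fin 5 → Fin 5} (hρ : Function.Injective ρ) (x : ParityVec) (m : Fin 5) :
    push ρ x (ρ m) = x m := by
  simp only [push, Fintype.linearCombination_apply, Finset.sum_apply, Pi.smul_apply, smul_eq_mul]
  rw [Finset.sum_eq_single m]
  · simp
  · intro b _ hb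
    rw [Pi.single_eq_of_ne (fun h => hb (hρ h.symm)), mul_zero]
  · simp

theorem push_injective {ρ : Fin 5 → Fin 5} (hρ : Function.Injective ρ) :
    Function.Injective (push ρ) := fun x y h => by
  funext m
  rw [← push_apply hρ x m, h, push_apply hρ y m]

theorem relabel_injective (j : Fin 3) (k : Fin 2) : Function.Injective (relabel j k) := by
  revert j k; decide

/-- Colour of the vertex stacked on a triangle with colours `0, 1, 2`. -/
def apexColor (k : Fin 2) : Fin 5 := Fin.natAdd 3 k

/-- Colours of the tetrahedron, with the apex last. -/
def tetraColor (k : Fin 2) : Fin 4 → Fin 5 :=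
  Fin.snoc (α := fun _ => Fin 5) (Fin.castLE (by norm_num)) (apexColor k)

theorem relabel_castLE (j : Fin 3) (k : Fin 2) (i : Fin 3) :
    relabel j k (Fin.castLE (by norm_num) i) = tetraColor k (j.castSucc.succAbove i) := by
  revert j k i; decide

/-- Parities in the tetrahedron due to the apex and its three neighbours. -/
def baseVec (k : Fin 2) : Fin 4 → ParityVec :=
  Fin.snoc (α := fun _ => ParityVec) (fun _ => Pi.single (apexColor k) 1)
    (∑ i : Fin 3, Pi.single (Fin.castLE (by norm_num) i) 1)

/-- Extension of an outcome on face `j` by zero. -/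
def extendVec (j : Fin 3) (x : Fin 3 → ParityVec) : Fin 4 → ParityVec :=
  Fin.insertNth (α := fun _ => ParityVec) j.castSucc 0 x

/-- Parities on a tetrahedron contributed by the apex and by outcomes on its three new faces. -/
def tetraVec (k : Fin 2) (y : Fin 3 → Fin 3 → ParityVec) : Fin 4 → ParityVec :=
  baseVec k + ∑ j, extendVec j (fun i => push (relabel j k) (y j i))

/-- Outcomes on a triangle obtained by stacking a vertex, with outcomes in `F j` on face `j`. -/
def stack (F : Fin 3 → Set (Fin 3 → ParityVec)) : Set (Fin 3 → ParityVec) :=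
  {z | ∃ k y, (∀ j, y j ∈ F j) ∧ tetraVec k y (Fin.last 3) ≠ 0 ∧
    ∀ i : Fin 3, z i = tetraVec k y i.castSucc}

/-! ### Soundness of the bit codes -/

/-- The parity vector at vertex `i` of a code. -/
def decode (n i : ℕ) : ParityVec := fun m => if n.testBit (5 * i + m) then 1 else 0

theorem decode_xor (a b i : ℕ) : decode (a ^^^ b) i = decode a i + decode b i := by
  funext m
  simp only [decode, Nat.testBit_xor, Pi.add_apply]
  cases a.testBit (5 * i + m) <;> cases b.testBit (5 * i + m) <;> decide

theorem decode_eq_iff (a b i : ℕ) : decode a i = decode b i ↔ field i a = field i b := by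
  constructor
  · intro h
    refine Nat.eq_of_testBit_eq fun m => ?_
    rw [field, field, show 32 = 2 ^ 5 from rfl, Nat.testBit_mod_two_pow, Nat.testBit_mod_two_pow,
      Nat.testBit_shiftRight, Nat.testBit_shiftRight]
    by_cases hm : m < 5
    · have := congrFun h ⟨m, hm⟩
      simp only [decode] at this
      cases ha : a.testBit (5 * i + m) <;> cases hb : b.testBit (5 * i + m) <;> simp_all
    · simp [hm]
  · intro h
    funext m
    have := congrArg (fun n => n.testBit m) h
    simp only [field] at this
    rw [show 32 = 2 ^ 5 from rfl, Nat.testBit_mod_two_pow, Nat.testBit_mod_two_pow,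
      Nat.testBit_shiftRight, Nat.testBit_shiftRight] at this
    simp only [m.isLt, decide_true, Bool.true_and] at this
    simp only [decode, this]

/-- Here `32768 = 2 ^ 15`: the three five-bit blocks of the triangle survive and the block of the
apex is dropped. -/
theorem decode_mod (n : ℕ) (i : Fin 3) : decode (n % 32768) i = decode n i := by
  rw [decode_eq_iff]
  fin_cases i <;> simp only [field, Nat.shiftRight_eq_div_pow] <;> norm_num <;> omega

theorem decode_two_pow (r : ℕ) (c : Fin 5) (p : ℕ) :
    decode (2 ^ (5 * r + c)) p = if p = r then Pi.single c 1 else 0 := by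
  funext m
  simp only [decode, Nat.testBit_two_pow, decide_eq_true_eq]
  split_ifs with h1 h2 h2
  · obtain rfl : c = m := by omega
    simp
  · omega
  · rw [Pi.single_eq_of_ne]
    rintro rfl; omega
  · rfl

theorem decode_cond (b : Bool) (n p : ℕ) :
    decode (bif b then n else 0) p = (if b then 1 else 0 : ZMod 2) • decode n p := by
  cases b
  · funext m; simp [decode]
  · simp

theorem decode_liftCode_eq_sum (j : Fin 3) (k : Fin 2) (n p : ℕ) :
    decode (liftCode j k n) p = ∑ i : Fin 3, ∑ m : Fin 5, decode n i m •
      (if p = j.castSucc.succAbove i then Pi.single (relabel j k m) 1 else 0 : ParityVec) := by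
  have h0 : decode 0 p = 0 := by funext m; simp [decode]
  simp only [liftCode, show List.finRange 3 = [0, 1, 2] from rfl,
    show List.finRange 5 = [0, 1, 2, 3, 4] from rfl, List.foldr_cons, List.foldr_nil, decode_xor,
    decode_cond, liftBit, decode_two_pow, h0, Fin.sum_univ_three, Fin.sum_univ_five]
  simp only [decode, add_assoc, add_zero]

theorem decode_liftCode (j : Fin 3) (k : Fin 2) (n : ℕ) (p : Fin 4) :
    decode (liftCode j k n) p = extendVec j (fun i => push (relabel j k) (decode n i)) p := by
  rw [decode_liftCode_eq_sum]
  rcases Fin.eq_self_or_eq_succAbove j.castSucc p with rfl | ⟨i, rfl⟩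
  · simp only [extendVec, Fin.insertNth_apply_same]
    refine Finset.sum_eq_zero fun i _ => Finset.sum_eq_zero fun m _ => ?_
    rw [if_neg, smul_zero]
    exact fun h => Fin.succAbove_ne _ i (Fin.ext h.symm)
  · simp only [extendVec, Fin.insertNth_apply_succAbove]
    rw [Finset.sum_eq_single i, push, Fintype.linearCombination_apply]
    · simp
    · intro i' _ hi
      refine Finset.sum_eq_zero fun m _ => ?_
      rw [if_neg, smul_zero]
      exact fun h => hi (Fin.succAbove_right_injective (Fin.ext h.symm))
    · simp

theorem decode_baseCode (k : Fin 2) (p : Fin 4) : decode (baseCode k) p = baseVec k p := by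
  revert k p; decide

/-- Only this direction is needed: goodness passes to larger sets, so it is enough that every listed
code is a genuine outcome. -/
theorem mem_compCode {t : Fin 3 → List ℕ} {n : ℕ} (h : n ∈ compCode t) :
    ∃ k, ∃ a : Fin 3 → ℕ, (∀ j, a j ∈ t j) ∧
      tetraVec k (fun j i => decode (a j) i) (Fin.last 3) ≠ 0 ∧
      ∀ i : Fin 3, decode n i = tetraVec k (fun j i => decode (a j) i) i.castSucc := by
  simp only [compCode, List.mem_flatMap, List.mem_filterMap, List.mem_map] at h
  obtain ⟨k, -, _, ⟨a, ha, rfl⟩, _, ⟨b, hb, rfl⟩, _, ⟨c, hc, rfl⟩, h⟩ := h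
  set N := baseCode k ^^^ (liftCode 0 k a ^^^ (liftCode 1 k b ^^^ liftCode 2 k c)) with hN
  have key : ∀ p : Fin 4, decode N p =
      tetraVec k (fun j i => decode ((![a, b, c] : Fin 3 → ℕ) j) i) p := by
    intro p
    simp only [hN, decode_xor, decode_baseCode, decode_liftCode, tetraVec, Pi.add_apply,
      Fin.sum_univ_three]
    simp [add_assoc]
  refine ⟨k, ![a, b, c], ?_, ?_, ?_⟩
  · intro j; fin_cases j <;> assumption
  · rw [← key]
    intro h0
    have : decode N 3 = decode 0 3 := by
      rw [show decode 0 3 = 0 from by funext m; simp [decode]]; exact h0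
    rw [decode_eq_iff] at this
    rw [show field 3 0 = 0 from rfl] at this
    simp [this] at h
  · intro i
    cases hb : (field 3 N).beq 0
    · rw [hb] at h
      simp only [cond_false, Option.some.injEq] at h
      rw [← key, ← h, decode_mod]
      rfl
    · rw [hb] at h; simp at h
-- If the first outcome is hit at `j`, then `t j` is known, so every outcome differing from it at
-- `j` is safe there and `j` can be dropped. Three vertices thus need depth 4, the last level
-- testing only that some outcome is left.
theorem noHit_spec {d : ℕ} {r S : List ℕ} (h : noHit d r S = true) (t : ℕ → ParityVec) :
    ∃ x ∈ S, ∀ i ∈ r, decode x i ≠ t i := by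
  induction d generalizing r S with
  | zero => simp [noHit] at h
  | succ d ih =>
    match S, h with
    | a :: S, h =>
      by_cases ha : ∀ i ∈ r, decode a i ≠ t i
      · exact ⟨a, by simp, ha⟩
      push Not at ha
      obtain ⟨j, hj, hja⟩ := ha
      rw [noHit, List.all_eq_true] at h
      obtain ⟨x, hx, hxr⟩ := ih (h j hj)
      rw [List.mem_filter] at hx
      refine ⟨x, hx.1, fun i hi => ?_⟩
      by_cases hij : i = j
      · subst hij
        rw [← hja]
        intro hd
        rw [decode_eq_iff] at hd
        simp [hd] at hx
      · exact hxr i ((List.mem_erase_of_ne hij).2 hi)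

/-! ### Good outcome sets and their closure properties -/

/-- Whatever parity vectors are forbidden at the three vertices, some outcome avoids them. -/
def NoHit (F : Set (Fin 3 → ParityVec)) : Prop :=
  ∀ t : Fin 3 → ParityVec, ∃ x ∈ F, ∀ i, x i ≠ t i

def outcome (n : ℕ) : Fin 3 → ParityVec := fun i => decode n i

/-- Outcome sets rich enough to be handled by the induction. -/
def Good (F : Set (Fin 3 → ParityVec)) : Prop :=
  NoHit F ∨ ∃ t ∈ stdTypes, ∀ n ∈ t, outcome n ∈ F

theorem NoHit.mono {F F' : Set (Fin 3 → ParityVec)} (h : NoHit F) (hF : F ⊆ F') : NoHit F' :=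
  fun t => let ⟨x, hx, hxt⟩ := h t; ⟨x, hF hx, hxt⟩

theorem good_of_goodCode {S : List ℕ} (h : goodCode S = true) {F : Set (Fin 3 → ParityVec)}
    (hS : ∀ n ∈ S, outcome n ∈ F) : Good F := by
  rw [goodCode, Bool.or_eq_true] at h
  rcases h with h | h
  · left
    intro t
    obtain ⟨x, hx, hxt⟩ := noHit_spec h (fun i => if hi : i < 3 then t ⟨i, hi⟩ else 0)
    refine ⟨outcome x, hS x hx, fun i => ?_⟩
    have := hxt i (by fin_cases i <;> simp)
    simpa [outcome] using this
  · right
    rw [List.any_eq_true] at h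
    obtain ⟨t, ht, h⟩ := h
    refine ⟨t, ht, fun n hn => ?_⟩
    rw [List.all_eq_true] at h
    have := h n hn
    rw [List.any_eq_true] at this
    obtain ⟨y, hy, hny⟩ := this
    rw [Nat.eq_of_beq_eq_true hny]
    exact hS y hy

theorem goodCode_sumCode : (stdTypes.all fun s => stdTypes.all fun t =>
    goodCode (sumCode s t)) = true := by decide +kernel

theorem goodCode_compCode : (stdTypes.all fun s => stdTypes.all fun t => stdTypes.all fun u =>
    goodCode (compCode ![s, t, u])) = true := by decide +kernel

/-- A fixed outcome of `F'` merely translates the forbidden vectors. -/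
theorem NoHit.add_left {F F' : Set (Fin 3 → ParityVec)} (h : NoHit F) (h' : F'.Nonempty) :
    NoHit {z | ∃ x ∈ F, ∃ y ∈ F', z = x + y} := by
  intro t
  obtain ⟨y, hy⟩ := h'
  obtain ⟨x, hx, hxt⟩ := h (t - y)
  refine ⟨x + y, ⟨x, hx, y, hy, rfl⟩, fun i hi => hxt i ?_⟩
  rw [Pi.sub_apply, ← hi]
  simp

theorem stdTypes_ne_nil : ∀ t ∈ stdTypes, t ≠ [] := by decide

theorem Good.nonempty {F : Set (Fin 3 → ParityVec)} (h : Good F) : F.Nonempty := by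
  rcases h with h | ⟨t, ht, h⟩
  · obtain ⟨x, hx, -⟩ := h 0
    exact ⟨x, hx⟩
  · obtain ⟨n, hn⟩ := List.exists_mem_of_ne_nil t (stdTypes_ne_nil t ht)
    exact ⟨_, h n hn⟩

theorem Good.add {F F' : Set (Fin 3 → ParityVec)} (h : Good F) (h' : Good F') :
    Good {z | ∃ x ∈ F, ∃ y ∈ F', z = x + y} := by
  rcases h with h | ⟨s, hs, h⟩
  · exact Or.inl (h.add_left h'.nonempty)
  rcases h' with h' | ⟨t, ht, h'⟩
  · refine Or.inl ((h'.add_left (Good.nonempty (Or.inr ⟨s, hs, h⟩))).mono ?_)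
    rintro _ ⟨x, hx, y, hy, rfl⟩
    exact ⟨y, hy, x, hx, add_comm _ _⟩
  · have hg := goodCode_sumCode
    simp only [List.all_eq_true] at hg
    refine good_of_goodCode (hg s hs t ht) fun n hn => ?_
    simp only [sumCode, List.mem_flatMap, List.mem_map] at hn
    obtain ⟨a, ha, b, hb, rfl⟩ := hn
    exact ⟨_, h a ha, _, h' b hb, funext fun i => decode_xor a b i⟩

/-- Either two outcomes disagree at `i`, or the trivial outcome is available. -/
theorem stdTypes_flexible : ∀ t ∈ stdTypes, ∀ i ∈ [0, 1, 2],
    (∃ a ∈ t, ∃ b ∈ t, field i a ≠ field i b) ∨ 0 ∈ t := by decide +kernel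

theorem Good.flexible {F : Set (Fin 3 → ParityVec)} (h : Good F) (i : Fin 3) :
    (∃ x ∈ F, ∃ y ∈ F, x i ≠ y i) ∨ 0 ∈ F := by
  rcases h with h | ⟨t, ht, h⟩
  · left
    obtain ⟨x, hx, -⟩ := h 0
    -- Forbidding `x` itself yields an outcome that differs from it at every corner.
    obtain ⟨y, hy, hyx⟩ := h x
    exact ⟨x, hx, y, hy, (hyx i).symm⟩
  · rcases stdTypes_flexible t ht i (by fin_cases i <;> simp) with ⟨a, ha, b, hb, hab⟩ | h0
    · exact Or.inl ⟨_, h a ha, _, h b hb, fun he => hab ((decode_eq_iff a b i).1 he)⟩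
    · right
      convert h 0 h0 using 1
      funext i m
      simp [outcome, decode]

theorem good_stack_of_std {F : Fin 3 → Set (Fin 3 → ParityVec)} (t : Fin 3 → List ℕ)
    (ht : ∀ j, t j ∈ stdTypes) (h : ∀ j, ∀ n ∈ t j, outcome n ∈ F j) : Good (stack F) := by
  have hg := goodCode_compCode
  simp only [List.all_eq_true] at hg
  have := hg _ (ht 0) _ (ht 1) _ (ht 2)
  rw [show ![t 0, t 1, t 2] = t from by funext j; fin_cases j <;> rfl] at this
  refine good_of_goodCode this fun n hn => ?_
  obtain ⟨k, a, ha, h0, hn⟩ := mem_compCode hn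
  exact ⟨k, fun j => outcome (a j), fun j => h j _ (ha j), h0, hn⟩

/-- `tetraVec` without the contribution of face `i`. -/
def tetraRest (k : Fin 2) (y : Fin 3 → Fin 3 → ParityVec) (i : Fin 3) : Fin 4 → ParityVec :=
  baseVec k + ∑ j ∈ Finset.univ.erase i, extendVec j (fun l => push (relabel j k) (y j l))

theorem tetraVec_update (k : Fin 2) (y : Fin 3 → Fin 3 → ParityVec) (i : Fin 3)
    (x : Fin 3 → ParityVec) : tetraVec k (Function.update y i x) =
      tetraRest k y i + extendVec i (fun l => push (relabel i k) (x l)) := by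
  rw [tetraVec, tetraRest, ← Finset.sum_erase_add _ _ (Finset.mem_univ i), ← add_assoc,
    Function.update_self]
  congr 2
  refine Finset.sum_congr rfl fun j hj => ?_
  rw [Function.update_of_ne (Finset.ne_of_mem_erase hj)]

/-- The faces through vertex `j` are those with index other than `j`. Either one of them offers two
different values at `j`, or all of them allow the zero outcome; then only the apex contributes at
`j`, and its two possible colours give two values. -/
theorem exists_tetraVec_ne {F : Fin 3 → Set (Fin 3 → ParityVec)} (h : ∀ j, Good (F j)) (j : Fin 3)
    (v : ParityVec) :
    ∃ k y, (∀ i, y i ∈ F i) ∧ tetraVec k y j.castSucc ≠ v := by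
  choose y₀ hy₀ using fun i => (h i).nonempty
  by_cases hflex : ∃ i l, i.castSucc.succAbove l = j.castSucc ∧ ∃ x ∈ F i, ∃ x' ∈ F i, x l ≠ x' l
  · obtain ⟨i, l, hl, x, hx, x', hx', hne⟩ := hflex
    have hmem : ∀ z ∈ F i, ∀ i', Function.update y₀ i z i' ∈ F i' := by
      intro z hz i'
      rcases eq_or_ne i' i with rfl | hi
      · simpa using hz
      · simpa [hi] using hy₀ i'
    by_contra! hc
    have h1 := (hc 0 _ (hmem x hx)).trans (hc 0 _ (hmem x' hx')).symm
    rw [tetraVec_update, tetraVec_update, Pi.add_apply, Pi.add_apply, add_right_inj, ← hl] at h1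
    simp only [extendVec, Fin.insertNth_apply_succAbove] at h1
    exact hne (push_injective (relabel_injective i 0) h1)
  · push Not at hflex
    have hzero : ∀ i ≠ j, (0 : Fin 3 → ParityVec) ∈ F i := by
      intro i hi
      obtain ⟨l, hl⟩ := Fin.exists_succAbove_eq (x := j.castSucc) (y := i.castSucc)
        (fun he => hi (Fin.castSucc_injective _ he).symm)
      rcases (h i).flexible l with ⟨x, hx, x', hx', hne⟩ | h0
      · exact absurd (hflex i l hl x hx x' hx') hne
      · exact h0
    have hval : ∀ k, tetraVec k (Function.update 0 j (y₀ j)) j.castSucc =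
        Pi.single (apexColor k) 1 := by
      intro k
      have h0 : ∀ i : Fin 3, extendVec i (fun _ => 0) = 0 := fun i => by
        funext p
        rcases Fin.eq_self_or_eq_succAbove i.castSucc p with rfl | ⟨l, rfl⟩ <;> simp [extendVec]
      rw [tetraVec_update]
      simp only [tetraRest, Pi.zero_apply, map_zero, h0, Finset.sum_const_zero]
      simp [extendVec, baseVec]
    have hmem : ∀ i, Function.update (0 : Fin 3 → Fin 3 → ParityVec) j (y₀ j) i ∈ F i := by
      intro i
      rcases eq_or_ne i j with rfl | hi
      · simpa using hy₀ i
      · simpa [hi] using hzero i hi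
    by_contra! hc
    have h1 := (hc 0 _ hmem).trans (hc 1 _ hmem).symm
    rw [hval, hval] at h1
    exact absurd h1 (by decide)

/-- Vertex `j` is the only one off face `j`, so it is settled first, by `exists_tetraVec_ne`.
Replacing the outcome on face `j` does not disturb it, and `NoHit` handles the other three vertices
at once. -/
theorem noHit_stack {F : Fin 3 → Set (Fin 3 → ParityVec)} (h : ∀ j, Good (F j)) {j : Fin 3}
    (hj : NoHit (F j)) : NoHit (stack F) := by
  intro t
  obtain ⟨k, y, hy, hv⟩ := exists_tetraVec_ne h j (t j)
  -- The final `0` encodes the requirement that the apex have a nonzero vector.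
  set T : Fin 4 → ParityVec := Fin.snoc (α := fun _ => ParityVec) t 0 with hT
  -- The forbidden vectors are corrected by the other contributions and pulled back to the colours
  -- of face `j`.
  obtain ⟨x, hx, hxt⟩ := hj fun l m =>
    (T (j.castSucc.succAbove l) - tetraRest k y j (j.castSucc.succAbove l)) (relabel j k m)
  have key : ∀ p, tetraVec k (Function.update y j x) p ≠ T p := by
    intro p
    rcases Fin.eq_self_or_eq_succAbove j.castSucc p with rfl | ⟨l, rfl⟩
    · rw [← Function.update_eq_self j y, tetraVec_update] at hv
      rw [tetraVec_update]
      simpa [extendVec, hT] using hv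
    · rw [tetraVec_update]
      intro he
      refine hxt l (funext fun m => ?_)
      rw [← he]
      simp [extendVec, push_apply (relabel_injective j k)]
  refine ⟨fun i => tetraVec k (Function.update y j x) i.castSucc, ⟨k, _, ?_, ?_, fun i => rfl⟩, ?_⟩
  · intro i
    rcases eq_or_ne i j with rfl | hi
    · simpa using hx
    · simpa [hi] using hy i
  · have hlast := key (Fin.last 3)
    rwa [hT, Fin.snoc_last] at hlast
  · intro i
    simpa [hT] using key i.castSucc

theorem good_stack {F : Fin 3 → Set (Fin 3 → ParityVec)} (h : ∀ j, Good (F j)) :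
    Good (stack F) := by
  by_cases hP : ∃ j, NoHit (F j)
  · obtain ⟨j, hj⟩ := hP
    exact Or.inl (noHit_stack h hj)
  · push Not at hP
    choose t ht hF using fun j => (h j).resolve_left (hP j)
    exact good_stack_of_std t ht hF

/-- Neighbour parities in a triangle with colours `0, 1, 2`. -/
def triangleVec (i : Fin 3) : ParityVec :=
  ∑ l : Fin 2, Pi.single (Fin.castLE (by norm_num) (i.succAbove l)) 1

theorem stdTypes_triangle : ∀ t ∈ stdTypes, ∃ n ∈ t, ∀ i : Fin 3,
    triangleVec i + outcome n i ≠ 0 := by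
  decide +kernel

theorem Good.exists_triangle {F : Set (Fin 3 → ParityVec)} (h : Good F) :
    ∃ x ∈ F, ∀ i, triangleVec i + x i ≠ 0 := by
  rcases h with h | ⟨t, ht, h⟩
  · obtain ⟨x, hx, hxt⟩ := h fun i => - triangleVec i
    exact ⟨x, hx, fun i hi => hxt i (neg_eq_of_add_eq_zero_right hi).symm⟩
  · obtain ⟨n, hn, hnt⟩ := stdTypes_triangle t ht
    exact ⟨_, h n hn, hnt⟩

theorem good_zero : Good {0} := by
  refine Or.inr ⟨[0], by simp [stdTypes], fun n hn => ?_⟩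
  rw [List.mem_singleton] at hn
  subst hn
  exact funext fun i => funext fun m => by simp [outcome, decode]

/-! ### Neighbour parities and outcomes placed in a graph -/

open Classical in
/-- Parity vector of the neighbours of `w` inside `W`. -/
noncomputable def nbrVec {V : Type*} [Fintype V] (G : SimpleGraph V) (W : Set V) (φ : V → Fin 5)
    (w : V) : ParityVec :=
  ∑ u with G.Adj w u ∧ u ∈ W, Pi.single (φ u) 1

theorem nbrVec_congr {V : Type*} [Fintype V] {G : SimpleGraph V} {W : Set V} {φ ψ : V → Fin 5}
    (h : ∀ u ∈ W, φ u = ψ u) (w : V) : nbrVec G W φ w = nbrVec G W ψ w := by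
  classical
  refine Finset.sum_congr rfl fun u hu => ?_
  rw [h u (Finset.mem_filter.1 hu).2.2]

section Place

variable {V : Type*} [DecidableEq V]

/-- Parity vectors `x i` placed at the vertices `q i`. -/
def place {n : ℕ} (q : Fin n → V) (x : Fin n → ParityVec) : V → ParityVec :=
  ∑ i, Pi.single (q i) (x i)

theorem place_add {n : ℕ} (q : Fin n → V) (x y : Fin n → ParityVec) :
    place q (x + y) = place q x + place q y := by
  simp [place, Pi.single_add, Finset.sum_add_distrib]

theorem place_zero {n : ℕ} (q : Fin n → V) : place q 0 = 0 := by simp [place]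

theorem place_sum {n : ℕ} {ι : Type*} (s : Finset ι) (q : Fin n → V) (x : ι → Fin n → ParityVec) :
    place q (∑ i ∈ s, x i) = ∑ i ∈ s, place q (x i) :=
  map_sum (⟨⟨place q, place_zero q⟩, place_add q⟩ : (Fin n → ParityVec) →+ (V → ParityVec)) x s

theorem place_apply_of_notMem {n : ℕ} (q : Fin n → V) (x : Fin n → ParityVec) {w : V}
    (h : ∀ i, q i ≠ w) : place q x w = 0 := by
  rw [place, Finset.sum_apply]
  exact Finset.sum_eq_zero fun i _ => Pi.single_eq_of_ne (h i).symm _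

theorem place_apply_self {n : ℕ} {q : Fin n → V} (hq : Function.Injective q)
    (x : Fin n → ParityVec) (i : Fin n) : place q x (q i) = x i := by
  rw [place, Finset.sum_apply, Finset.sum_eq_single i]
  · simp
  · intro j _ hj
    exact Pi.single_eq_of_ne (fun h => hj (hq h).symm) _
  · simp

theorem place_face (q : Fin 4 → V) (j : Fin 3) (x : Fin 3 → ParityVec) :
    place (q ∘ j.castSucc.succAbove) x = place q (extendVec j x) := by
  rw [place, place, Fin.sum_univ_succAbove _ j.castSucc]
  simp [extendVec]

theorem place_castSucc (q : Fin 4 → V) (x : Fin 3 → ParityVec) :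
    place (q ∘ Fin.castSucc) x = place q (Fin.snoc (α := fun _ => ParityVec) x 0) := by
  rw [place, place, Fin.sum_univ_castSucc (n := 3)]
  simp only [Fin.snoc_castSucc, Fin.snoc_last, Pi.single_zero, add_zero, Function.comp_apply]

end Place

/-! ### The inductive step: stacking a vertex -/

/-- `x` is the actual parity vector of some outcome in `F` on the triangle `T` coloured by `φ`. -/
def Realizes {V : Type*} (φ : V → Fin 5) (T : Fin 3 → V) (F : Set (Fin 3 → ParityVec))
    (x : Fin 3 → ParityVec) : Prop :=
  ∃ ρ : Fin 5 → Fin 5, Function.Injective ρ ∧ ∃ y ∈ F,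
    (∀ i : Fin 3, ρ (Fin.castLE (by norm_num) i) = φ (T i)) ∧ x = fun i => push ρ (y i)

/-- `G` restricted to `W` can be properly coloured, with good outcome sets attached to the triangles
in `𝒯`, such that all parity vectors are nonzero. -/
structure Solvable {V : Type*} [Fintype V] [DecidableEq V] (G : SimpleGraph V) (W : Set V)
    (𝒯 : Set (Fin 3 → V)) : Prop where
  mem : ∀ T ∈ 𝒯, ∀ i, T i ∈ W
  inj : ∀ T ∈ 𝒯, Function.Injective T
  cover : ∀ S ⊆ W, G.IsClique S → S.ncard = 3 → ∃ T ∈ 𝒯, Set.range T = S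
  solve : ∀ F : (Fin 3 → V) → Set (Fin 3 → ParityVec), (∀ T ∈ 𝒯, Good (F T)) →
    ∃ φ : V → Fin 5, ∃ x : (Fin 3 → V) → Fin 3 → ParityVec,
      (∀ u ∈ W, ∀ w ∈ W, G.Adj u w → φ u ≠ φ w) ∧
      (∀ T ∈ 𝒯, Realizes φ T (F T) (x T)) ∧ (∀ T ∉ 𝒯, x T = 0) ∧
      ∀ w ∈ W, nbrVec G W φ w + (∑ T, place T (x T)) w ≠ 0

theorem apexColor_ne (k : Fin 2) (i : Fin 3) : apexColor k ≠ Fin.castLE (by norm_num) i := by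
  revert k i; decide

theorem push_extendVec (ρ : Fin 5 → Fin 5) (j : Fin 3) (x : Fin 3 → ParityVec) (p : Fin 4) :
    push ρ (extendVec j x p) = extendVec j (fun i => push ρ (x i)) p := by
  rcases Fin.eq_self_or_eq_succAbove j.castSucc p with rfl | ⟨i, rfl⟩ <;> simp [extendVec]

theorem sum_place_single {V : Type*} [Fintype V] [DecidableEq V] {n : ℕ} (T : Fin n → V)
    (x : Fin n → ParityVec) :
    ∑ T', place T' ((Pi.single T x : (Fin n → V) → Fin n → ParityVec) T') = place T x := by
  rw [Finset.sum_eq_single T]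
  · rw [Pi.single_eq_same]
  · intro T' _ hne
    rw [Pi.single_eq_of_ne hne, place_zero]
  · simp

section Step

variable {V : Type*} [Fintype V] [DecidableEq V] {G : SimpleGraph V} {W : Set V}

open Classical in
theorem nbrVec_insert {v w : V} (hv : v ∉ W) (φ : V → Fin 5) :
    nbrVec G (insert v W) φ w = nbrVec G W φ w + if G.Adj w v then Pi.single (φ v) 1 else 0 := by
  split_ifs with h
  · rw [nbrVec, nbrVec, add_comm, ← Finset.sum_insert (a := v)
      (f := fun u => (Pi.single (φ u) 1 : ParityVec)) (by simp [hv])]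
    refine Finset.sum_congr ?_ fun _ _ => rfl
    ext u
    simp only [Finset.mem_filter, Finset.mem_univ, true_and, Set.mem_insert_iff, Finset.mem_insert]
    constructor
    · rintro ⟨h1, rfl | h2⟩
      · exact Or.inl rfl
      · exact Or.inr ⟨h1, h2⟩
    · rintro (rfl | ⟨h1, h2⟩)
      · exact ⟨h, Or.inl rfl⟩
      · exact ⟨h1, Or.inr h2⟩
  · rw [nbrVec, nbrVec, add_zero]
    congr 1
    ext u
    simp only [Finset.mem_filter, Finset.mem_univ, true_and, Set.mem_insert_iff]
    constructor
    · rintro ⟨h1, rfl | h2⟩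
      · exact absurd h1 h
      · exact ⟨h1, h2⟩
    · rintro ⟨h1, h2⟩
      exact ⟨h1, Or.inr h2⟩

theorem nbrVec_eq_of_range {n : ℕ} {q : Fin n → V} (hq : Function.Injective q) {w : V}
    (h : Set.range q = G.neighborSet w ∩ W) (φ : V → Fin 5) :
    nbrVec G W φ w = ∑ i, Pi.single (φ (q i)) 1 := by
  classical
  rw [nbrVec, ← Finset.sum_image (f := fun u => (Pi.single (φ u) 1 : ParityVec)) (hq.injOn)]
  refine Finset.sum_congr ?_ fun _ _ => rfl
  ext u
  have := Set.ext_iff.1 h u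
  simp only [Set.mem_range, Set.mem_inter_iff, SimpleGraph.mem_neighborSet] at this
  simp [this]

/-- Solvability is preserved when a vertex is stacked on a triangle: outcomes on the new faces are
passed down to the triangle by `stack`. -/
theorem solvable_insert {𝒯 : Set (Fin 3 → V)} (h : Solvable G W 𝒯) {v : V} (hv : v ∉ W)
    (hc : G.IsClique (G.neighborSet v ∩ W)) (h3 : (G.neighborSet v ∩ W).ncard = 3) :
    ∃ 𝒯', Solvable G (insert v W) 𝒯' := by
  obtain ⟨T, hT, hTr⟩ := h.cover _ Set.inter_subset_right hc h3
  have hTW : ∀ i, T i ∈ W := h.mem T hT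
  have hTi : Function.Injective T := h.inj T hT
  have hvT : ∀ i, T i ≠ v := fun i he => hv (he ▸ hTW i)
  set q : Fin 4 → V := Fin.snoc (α := fun _ => V) T v with hq
  have hqT : q ∘ Fin.castSucc = T := funext fun i => by simp [hq]
  have hqv : q (Fin.last 3) = v := by rw [hq, Fin.snoc_last]
  have hqi : Function.Injective q := by
    rw [hq, Fin.snoc_injective_iff]
    exact ⟨hTi, fun ⟨i, hi⟩ => hvT i hi⟩
  let face : Fin 3 → Fin 3 → V := fun j => q ∘ j.castSucc.succAbove
  have hface2 : ∀ j, face j 2 = v := by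
    intro j
    have : j.castSucc.succAbove 2 = Fin.last 3 := by revert j; decide
    simp only [face, Function.comp_apply, this, hqv]
  have hfaceT : ∀ j, face j ∉ 𝒯 := fun j hj => hv (hface2 j ▸ h.mem _ hj 2)
  have hfacei : Function.Injective face := by
    intro j j' hjj
    have h1 : j.castSucc.succAbove = j'.castSucc.succAbove := hqi.comp_left hjj
    exact Fin.castSucc_injective _ (Fin.succAbove_left_injective h1)
  refine ⟨𝒯 ∪ Set.range face, ?_, ?_, ?_, ?_⟩
  · rintro T' (hT' | ⟨j, rfl⟩) i
    · exact Or.inr (h.mem T' hT' i)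
    · simp only [face, Function.comp_apply]
      refine Fin.lastCases ?_ (fun i => ?_) (j.castSucc.succAbove i)
      · rw [hqv]; exact Or.inl rfl
      · rw [← Function.comp_apply (f := q), hqT]; exact Or.inr (hTW i)
  · rintro T' (hT' | ⟨j, rfl⟩)
    · exact h.inj T' hT'
    · exact hqi.comp Fin.succAbove_right_injective
  · intro S hS hSc hS3
    -- A 3-clique through `v` lies in the tetrahedron on `T` and `v`; it misses some `T j`, hence
    -- equals `face j`.
    by_cases hvS : v ∈ S
    · have hsub : S \ {v} ⊆ Set.range T := by
        rintro u ⟨hu, huv⟩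
        rw [hTr]
        exact ⟨hSc hvS hu (Ne.symm huv), (hS hu).resolve_left huv⟩
      have h2 : (S \ {v}).ncard = 2 := by
        rw [Set.ncard_sdiff_singleton_of_mem hvS, hS3]
      have hne : ∃ j, T j ∉ S := by
        by_contra! hall
        have : Set.range T ⊆ S \ {v} := by
          rintro _ ⟨i, rfl⟩
          exact ⟨hall i, hvT i⟩
        have := Set.ncard_le_ncard this (Set.toFinite _)
        rw [h2, hTr, h3] at this
        omega
      obtain ⟨j, hj⟩ := hne
      refine ⟨face j, Or.inr ⟨j, rfl⟩, ?_⟩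
      symm
      refine Set.eq_of_subset_of_ncard_le ?_ ?_ (Set.toFinite _)
      · intro u hu
        have hqu : ∃ p, q p = u := by
          by_cases huv : u = v
          · exact ⟨Fin.last 3, by rw [hqv, huv]⟩
          · obtain ⟨i, rfl⟩ := hsub ⟨hu, huv⟩
            exact ⟨i.castSucc, congrFun hqT i⟩
        obtain ⟨p, rfl⟩ := hqu
        have hp : p ≠ j.castSucc := by
          rintro rfl
          rw [← Function.comp_apply (f := q), hqT] at hu
          exact hj hu
        obtain ⟨i, rfl⟩ := Fin.exists_succAbove_eq hp
        exact ⟨i, rfl⟩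
      · rw [hS3, ← Set.image_univ,
          Set.ncard_image_of_injective _ (hqi.comp Fin.succAbove_right_injective)]
        simp [Set.ncard_univ]
    · obtain ⟨T', hT', hr⟩ := h.cover S (fun u hu => (hS hu).resolve_left
        (fun (he : u = v) => hvS (he ▸ hu))) hSc hS3
      exact ⟨T', Or.inl hT', hr⟩
  · intro F hF
    -- In the smaller graph, `T` must account for its own outcome and for all that `v` and the new
    -- faces will add.
    obtain ⟨φ, x, hφ, hx, hx0, hw⟩ := h.solve
      (Function.update F T {z | ∃ a ∈ F T, ∃ b ∈ stack fun j => F (face j), z = a + b}) (by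
        intro T' hT'
        rcases eq_or_ne T' T with rfl | hne
        · rw [Function.update_self]
          exact (hF _ (Or.inl hT)).add (good_stack fun j => hF _ (Or.inr ⟨j, rfl⟩))
        · rw [Function.update_of_ne hne]
          exact hF _ (Or.inl hT'))
    obtain ⟨ρ, hρ, _, ⟨u, hu, z, ⟨k, y, hy, hlast, hz⟩, rfl⟩, hρT, hxT⟩ := by
      simpa only [Function.update_self] using hx T hT
    let c := ρ (apexColor k)
    let φ' := Function.update φ v c
    have hφW : ∀ w ∈ W, φ' w = φ w := fun w hw' =>
      Function.update_of_ne (ne_of_mem_of_not_mem hw' hv) _ _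
    have hφv : φ' v = c := Function.update_self _ _ _
    have hφT : ∀ i, φ' (T i) = ρ (Fin.castLE (by norm_num) i) := fun i => by
      rw [hφW _ (hTW i), hρT]
    have hφq : ∀ p, φ' (q p) = ρ (tetraColor k p) := by
      intro p
      refine Fin.lastCases ?_ (fun i => ?_) p
      · rw [hqv, hφv, tetraColor, Fin.snoc_last]
      · rw [← Function.comp_apply (f := q), hqT, hφT, tetraColor, Fin.snoc_castSucc]
    have hnv : ∀ w ∈ W, G.Adj v w → φ' v ≠ φ' w := by
      intro w hw' hvw
      obtain ⟨i, rfl⟩ : w ∈ Set.range T := by rw [hTr]; exact ⟨hvw, hw'⟩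
      rw [hφv, hφT]
      intro he
      have := hρ he
      exact apexColor_ne k i this
    have hxv : (∑ T', place T' (x T')) v = 0 := by
      rw [Finset.sum_apply]
      refine Finset.sum_eq_zero fun T' _ => ?_
      by_cases hT' : T' ∈ 𝒯
      · exact place_apply_of_notMem _ _ fun i he => hv (he ▸ h.mem T' hT' i)
      · rw [hx0 T' hT', place_zero, Pi.zero_apply]
    let zρ : Fin 3 → ParityVec := fun i => push ρ (z i)
    let yρ : Fin 3 → Fin 3 → ParityVec := fun j i => push ρ (push (relabel j k) (y j i))
    -- In characteristic 2, adding `zρ` again at `T` cancels the share that stood for `v` and its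
    -- faces; the actual face outcomes replace it.
    let x' : (Fin 3 → V) → Fin 3 → ParityVec := x + Pi.single T zρ + ∑ j, Pi.single (face j) (yρ j)
    have hsum : ∑ T', place T' (x' T') = ∑ T', place T' (x T') + place T zρ +
        ∑ j, place (face j) (yρ j) := by
      simp only [x', Pi.add_apply, place_add, Finset.sum_add_distrib, sum_place_single,
        Finset.sum_apply, place_sum]
      rw [Finset.sum_comm]
      simp only [sum_place_single]
    -- The replacement balances exactly on `T`: parities on `W` are unchanged, and only the nonzero
    -- vector of the apex remains, at `v`.
    have hfaces : place T zρ + ∑ j, place (face j) (yρ j) + place q (fun p => push ρ (baseVec k p)) =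
        Pi.single v (push ρ (tetraVec k y (Fin.last 3))) := by
      have h1 : place T zρ = place q (Fin.snoc (α := fun _ => ParityVec) zρ 0) := by
        rw [← place_castSucc, hqT]
      have h2 : ∀ j, place (face j) (yρ j) = place q (extendVec j (yρ j)) := fun j => place_face q j _
      simp only [h1, h2, ← place_sum, ← place_add]
      have h3 : ∀ p, (∑ j, extendVec j (yρ j)) p + push ρ (baseVec k p) =
          push ρ (tetraVec k y p) := by
        intro p
        rw [tetraVec, add_comm, Pi.add_apply, map_add, Finset.sum_apply, Finset.sum_apply, map_sum]
        congr 1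
        exact Finset.sum_congr rfl fun j _ => (push_extendVec ρ j _ p).symm
      rw [place, Fin.sum_univ_castSucc, Finset.sum_eq_zero, zero_add, hqv]
      · simp only [Pi.add_apply, Fin.snoc_last, zero_add, ← h3]
      · intro i _
        rw [Pi.add_apply, Pi.add_apply, Fin.snoc_castSucc, add_assoc, h3, ← hz,
          CharTwo.add_self_eq_zero, Pi.single_zero]
    have hnbr : ∀ w ∈ W, nbrVec G (insert v W) φ' w =
        nbrVec G W φ w + place q (fun p => push ρ (baseVec k p)) w := by
      classical
      intro w hwW
      rw [nbrVec_insert hv, nbrVec_congr hφW]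
      congr 1
      split_ifs with hadj
      · obtain ⟨i, rfl⟩ : w ∈ Set.range T := by rw [hTr]; exact ⟨hadj.symm, hwW⟩
        have : T i = q i.castSucc := (congrFun hqT i).symm
        rw [this, place_apply_self hqi, baseVec, Fin.snoc_castSucc, push_single, hφv]
      · rw [place_apply_of_notMem]
        intro p
        refine Fin.lastCases ?_ (fun i => ?_) p
        · rw [hqv]; rintro rfl; exact hv hwW
        · rw [← Function.comp_apply (f := q), hqT]
          rintro rfl
          have : T i ∈ G.neighborSet v ∩ W := hTr ▸ ⟨i, rfl⟩
          exact hadj this.1.symm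
    have hnbrv : nbrVec G (insert v W) φ' v = place q (fun p => push ρ (baseVec k p)) v := by
      classical
      rw [nbrVec_insert hv, if_neg (G.loopless.irrefl v), add_zero, nbrVec_eq_of_range hTi hTr]
      have hself := place_apply_self hqi (fun p => push ρ (baseVec k p)) (Fin.last 3)
      rw [hqv] at hself
      rw [hself, baseVec, Fin.snoc_last, map_sum]
      exact Finset.sum_congr rfl fun i _ => by rw [push_single, hφT]
    have hTface : ∀ j, T ≠ face j := fun j he => hfaceT j (he ▸ hT)
    refine ⟨φ', x', ?_, ?_, ?_, ?_⟩
    · rintro a (rfl | ha) b (rfl | hb) hab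
      · exact absurd hab (G.loopless.irrefl _)
      · exact hnv b hb hab
      · exact (hnv a ha hab.symm).symm
      · rw [hφW a ha, hφW b hb]; exact hφ a ha b hb hab
    · rintro T' (hT' | ⟨j, rfl⟩)
      · have hf : ∀ j, T' ≠ face j := fun j he => hfaceT j (he ▸ hT')
        rcases eq_or_ne T' T with rfl | hne
        · refine ⟨ρ, hρ, u, hu, fun i => (hφT i).symm, ?_⟩
          simp only [x', Pi.add_apply, Finset.sum_apply, Pi.single_eq_same,
            Pi.single_eq_of_ne (hf _), Finset.sum_const_zero, add_zero, hxT]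
          funext i
          simp only [Pi.add_apply, map_add, zρ, add_assoc, CharTwo.add_self_eq_zero, add_zero]
        · obtain ⟨σ, hσ, a, ha, hσT, hxa⟩ := hx T' hT'
          rw [Function.update_of_ne hne] at ha
          refine ⟨σ, hσ, a, ha, fun i => ?_, ?_⟩
          · rw [hφW _ (h.mem T' hT' i), hσT]
          · simp only [x', Pi.add_apply, Finset.sum_apply, Pi.single_eq_of_ne hne,
              Pi.single_eq_of_ne (hf _), Finset.sum_const_zero, add_zero, hxa]
      · refine ⟨ρ ∘ relabel j k, hρ.comp (relabel_injective j k), y j, hy j, fun i => ?_, ?_⟩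
        · simp only [face, Function.comp_apply]
          rw [relabel_castLE, hφq]
        · simp only [x', Pi.add_apply, Finset.sum_apply, hx0 _ (hfaceT j),
            Pi.single_eq_of_ne (hTface j).symm, zero_add]
          rw [Finset.sum_eq_single j]
          · funext i
            simp only [Pi.single_eq_same, yρ, push_push]
          · intro j' _ hj'
            exact Pi.single_eq_of_ne (fun he => hj' (hfacei he).symm) _
          · simp
    · intro T' hT'
      rw [Set.mem_union, not_or] at hT'
      have hf : ∀ j, T' ≠ face j := fun j he => hT'.2 ⟨j, he.symm⟩
      have hne : T' ≠ T := fun he => hT'.1 (he ▸ hT)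
      simp only [x', Pi.add_apply, Finset.sum_apply, Pi.single_eq_of_ne hne,
        Pi.single_eq_of_ne (hf _), Finset.sum_const_zero, add_zero, hx0 T' hT'.1]
    · intro w hwW
      have hfw := congrFun hfaces w
      simp only [Pi.add_apply] at hfw
      rw [hsum]
      rcases hwW with rfl | hwW
      · rw [Pi.single_eq_same] at hfw
        have : nbrVec G (insert w W) φ' w + (∑ T', place T' (x T') + place T zρ +
            ∑ j, place (face j) (yρ j)) w = push ρ (tetraVec k y (Fin.last 3)) := by
          rw [hnbrv, ← hfw]
          simp only [Pi.add_apply, hxv]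
          abel
        rw [this, ← map_zero (push ρ)]
        exact fun he => hlast (push_injective hρ he)
      · rw [Pi.single_eq_of_ne (ne_of_mem_of_not_mem hwW hv)] at hfw
        have : nbrVec G (insert v W) φ' w + (∑ T', place T' (x T') + place T zρ +
            ∑ j, place (face j) (yρ j)) w = nbrVec G W φ w + (∑ T', place T' (x T')) w := by
          rw [hnbr w hwW, ← add_zero (nbrVec G W φ w + (∑ T', place T' (x T')) w), ← hfw]
          simp only [Pi.add_apply]
          abel
        rw [this]
        exact hw w hwW

end Step

/-! ### From solvability to an odd colouring -/

theorem exists_odd_of_nbrVec_ne_zero {V : Type*} [Fintype V] {G : SimpleGraph V} {φ : V → Fin 5}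
    {w : V} (h : nbrVec G Set.univ φ w ≠ 0) :
    ∃ i, Odd {u | u ∈ G.neighborSet w ∧ φ u = i}.ncard := by
  classical
  obtain ⟨i, hi⟩ := Function.ne_iff.1 h
  refine ⟨i, ?_⟩
  rw [← ZMod.natCast_ne_zero_iff_odd]
  rw [Pi.zero_apply] at hi
  convert hi using 1
  rw [nbrVec, Finset.sum_apply]
  simp only [Pi.single_apply]
  rw [Finset.sum_boole, Finset.filter_filter, ← Set.ncard_coe_finset]
  congr 2
  ext u
  simp [eq_comm]

section Colour

variable {V : Type*} [Fintype V] [DecidableEq V] {G : SimpleGraph V}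

theorem solvable_triangle {W : Set V} {T : Fin 3 → V} (hTi : Function.Injective T)
    (hTr : Set.range T = W) (hW : G.IsClique W) : Solvable G W {T} := by
  refine ⟨?_, ?_, ?_, ?_⟩
  · rintro _ rfl i
    exact hTr ▸ ⟨i, rfl⟩
  · rintro _ rfl
    exact hTi
  · intro S hS _ hS3
    refine ⟨T, rfl, ?_⟩
    rw [hTr]
    symm
    refine Set.eq_of_subset_of_ncard_le hS ?_ (Set.toFinite _)
    rw [hS3, ← hTr, ← Set.image_univ, Set.ncard_image_of_injective _ hTi]
    simp [Set.ncard_univ]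
  · intro F hF
    obtain ⟨x, hx, hne⟩ := (hF T rfl).exists_triangle
    -- The default colour `0` is harmless: only colours inside `W` count.
    let φ : V → Fin 5 := Function.extend T (Fin.castLE (by norm_num)) 0
    have hφ : ∀ i, φ (T i) = Fin.castLE (by norm_num) i := fun i => hTi.extend_apply _ _ i
    refine ⟨φ, Pi.single T x, ?_, ?_, ?_, ?_⟩
    · rw [← hTr]
      rintro _ ⟨i, rfl⟩ _ ⟨j, rfl⟩ hadj he
      rw [hφ, hφ, Fin.castLE_inj] at he
      exact hadj.ne (congrArg T he)
    · rintro _ rfl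
      refine ⟨id, Function.injective_id, x, hx, fun i => (hφ i).symm, ?_⟩
      rw [Pi.single_eq_same]
      funext i m
      exact (push_apply Function.injective_id (x i) m).symm
    · intro T' hT'
      exact Pi.single_eq_of_ne hT' _
    · intro w hw
      obtain ⟨i, rfl⟩ : w ∈ Set.range T := hTr ▸ hw
      rw [sum_place_single, place_apply_self hTi,
        nbrVec_eq_of_range (q := T ∘ i.succAbove) (hTi.comp Fin.succAbove_right_injective)]
      · simp only [Function.comp_apply, hφ]
        exact hne i
      · ext u
        constructor
        · rintro ⟨l, rfl⟩
          have hl : T (i.succAbove l) ∈ W := hTr ▸ ⟨_, rfl⟩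
          exact ⟨hW hw hl fun he => Fin.succAbove_ne i l (hTi he).symm, hl⟩
        · rintro ⟨hadj, hu⟩
          rw [← hTr] at hu
          obtain ⟨l, rfl⟩ := hu
          have hadj' : G.Adj (T i) (T l) := hadj
          obtain ⟨m, rfl⟩ := Fin.exists_succAbove_eq (x := l) (y := i)
            (by rintro rfl; exact hadj'.ne rfl)
          exact ⟨m, rfl⟩

theorem IsKTree.exists_solvable (h : IsKTree 3 G) : ∃ 𝒯, Solvable G Set.univ 𝒯 := by
  obtain ⟨s, W, ⟨hc, h4⟩, hs, hstep⟩ := h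
  have main : ∀ i ≤ s, ∃ 𝒯, Solvable G (W i) 𝒯 := by
    intro i
    induction i with
    | zero =>
      intro _
      -- The initial `K₄` is treated as a triangle with one vertex stacked on it.
      obtain ⟨v, hv⟩ : (W 0).Nonempty := by
        rw [← Set.ncard_pos]; omega
      have h3 : (W 0 \ {v}).ncard = 3 := by
        rw [Set.ncard_sdiff_singleton_of_mem hv, h4]
      have hc' : G.IsClique (W 0 \ {v}) := hc.subset Set.sdiff_subset
      obtain ⟨x, y, z, hxy, hxz, hyz, he⟩ := Set.ncard_eq_three.1 h3
      have hsol : Solvable G (W 0 \ {v}) {![x, y, z]} := by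
        refine solvable_triangle ?_ ?_ hc'
        · intro a b hab
          fin_cases a <;> fin_cases b <;> simp_all
        · rw [he]
          ext u
          simp [eq_comm, or_comm, or_left_comm]
      have hN : G.neighborSet v ∩ (W 0 \ {v}) = W 0 \ {v} :=
        Set.inter_eq_right.2 fun u hu => hc hv hu.1 (Ne.symm hu.2)
      have := solvable_insert hsol (v := v) (by simp) (by rwa [hN]) (by rwa [hN])
      rwa [Set.insert_sdiff_singleton, Set.insert_eq_of_mem hv] at this
    | succ i ih =>
      intro hi
      obtain ⟨𝒯, h𝒯⟩ := ih (by omega)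
      obtain ⟨v, hv, he, hcl, hn⟩ := hstep i (by omega)
      rw [he]
      exact solvable_insert h𝒯 hv hcl hn
  exact hs ▸ main s le_rfl

theorem Solvable.oddColorable {𝒯 : Set (Fin 3 → V)} (h : Solvable G Set.univ 𝒯) :
    OddColorable G 5 := by
  obtain ⟨φ, x, hφ, hx, hx0, hne⟩ := h.solve (fun _ => {0}) fun _ _ => good_zero
  have hx' : ∀ T, x T = 0 := by
    intro T
    by_cases hT : T ∈ 𝒯
    · obtain ⟨ρ, -, _, rfl, -, hxT⟩ := hx T hT
      rw [hxT]
      funext i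
      simp
    · exact hx0 T hT
  refine ⟨SimpleGraph.Coloring.mk φ fun {u w} hadj => hφ u trivial w trivial hadj, fun w _ => ?_⟩
  have := hne w trivial
  simp only [hx', place_zero, Finset.sum_const_zero, Pi.zero_apply, add_zero] at this
  exact exists_odd_of_nbrVec_ne_zero this

end Colour

/-! ### A 3-tree that is not odd 4-colorable -/

/-- A vertex `3` joined to the triangulated hexagon on `0, 1, 2, 4, 5, 6`. -/
def hexagonCone : SimpleGraph (Fin 7) :=
  SimpleGraph.fromEdgeSet {s(0, 1), s(0, 2), s(1, 2), s(0, 3), s(1, 3), s(2, 3), s(0, 4), s(1, 4),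
    s(3, 4), s(1, 5), s(3, 5), s(4, 5), s(3, 6), s(4, 6), s(5, 6)}

instance : DecidableRel hexagonCone.Adj := by
  unfold hexagonCone
  infer_instance

theorem isKTree_hexagonCone : IsKTree 3 hexagonCone := by
  have hcard : ∀ (p : Fin 7 → Prop) [DecidablePred p],
      {w | p w}.ncard = (Finset.univ.filter p).card := fun p _ => by
    rw [← Set.ncard_coe_finset]; simp
  refine ⟨3, fun i => {w | (w : ℕ) < 4 + i}, ⟨?_, ?_⟩, ?_, ?_⟩
  · have : ∀ u : Fin 7, (u : ℕ) < 4 → ∀ w : Fin 7, (w : ℕ) < 4 → u ≠ w → hexagonCone.Adj u w := by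
      decide
    exact fun u hu w hw => this u hu w hw
  · rw [hcard]
    decide
  · ext w
    simp
  · intro i hi
    obtain ⟨i, rfl⟩ : ∃ j : Fin 3, (j : ℕ) = i := ⟨⟨i, hi⟩, rfl⟩
    refine ⟨Fin.natAdd 4 i, by simp, ?_, ?_, ?_⟩
    · ext w
      simp only [Set.mem_ofPred_eq, Set.mem_insert_iff, Fin.ext_iff, Fin.val_natAdd]
      omega
    · have : ∀ i : Fin 3, ∀ u : Fin 7, hexagonCone.Adj (Fin.natAdd 4 i) u ∧ (u : ℕ) < 4 + i →
          ∀ w : Fin 7, hexagonCone.Adj (Fin.natAdd 4 i) w ∧ (w : ℕ) < 4 + i →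
            u ≠ w → hexagonCone.Adj u w := by decide
      exact fun u hu w hw => this i u hu w hw
    · change {w | hexagonCone.Adj (Fin.natAdd 4 i) w ∧ (w : ℕ) < 4 + i}.ncard = 3
      rw [hcard]
      revert i
      decide

/-- With four colours each stacked vertex has a forced colour, so vertices `4, 5, 6` repeat the
colours of `2, 0, 1`. Vertex `3` then sees three colours twice each and its own colour never. -/
theorem not_oddColorable_hexagonCone : ¬ OddColorable hexagonCone 4 := by
  rintro ⟨φ, hφ⟩
  have hv : ∀ u w, hexagonCone.Adj u w → (φ u : ℕ) ≠ φ w := fun u w h he =>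
    φ.valid h (Fin.ext he)
  have h01 := hv 0 1 (by decide)
  have h02 := hv 0 2 (by decide)
  have h12 := hv 1 2 (by decide)
  have h03 := hv 0 3 (by decide)
  have h13 := hv 1 3 (by decide)
  have h23 := hv 2 3 (by decide)
  have h4 : φ 4 = φ 2 := by
    have := hv 0 4 (by decide)
    have := hv 1 4 (by decide)
    have := hv 3 4 (by decide)
    omega
  have h5 : φ 5 = φ 0 := by
    have := hv 1 5 (by decide)
    have := hv 3 5 (by decide)
    have := hv 4 5 (by decide)
    omega
  have h6 : φ 6 = φ 1 := by
    have := hv 3 6 (by decide)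
    have := hv 4 6 (by decide)
    have := hv 5 6 (by decide)
    omega
  obtain ⟨i, hi⟩ := hφ 3 ⟨0, by rw [SimpleGraph.mem_neighborSet]; decide⟩
  have hset : {w | w ∈ hexagonCone.neighborSet 3 ∧ φ w = i} =
      (Finset.univ.filter fun w => w ≠ 3 ∧ φ w = i : Finset (Fin 7)) := by
    ext w
    have : ∀ w, hexagonCone.Adj 3 w ↔ w ≠ 3 := by decide
    simp [this]
  rw [hset, Set.ncard_coe_finset, Finset.card_filter, Fin.sum_univ_seven, h4, h5, h6,
    ← Nat.not_even_iff_odd] at hi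
  apply hi
  simp only [ne_eq, show ((0 : Fin 7) = 3) = False by decide,
    show ((1 : Fin 7) = 3) = False by decide, show ((2 : Fin 7) = 3) = False by decide,
    show ((4 : Fin 7) = 3) = False by decide, show ((5 : Fin 7) = 3) = False by decide,
    show ((6 : Fin 7) = 3) = False by decide,
    not_false_eq_true, not_true_eq_false, true_and, false_and, if_false]
  rw [Nat.even_iff]
  omega

theorem theorem1p5 :
    (∀ (V : Type*) [Finite V] (G : SimpleGraph V), IsKTree 3 G → OddColorable G 5) ∧
    (∃ (n : ℕ) (G : SimpleGraph (Fin n)), IsKTree 3 G ∧ ¬ OddColorable G 4) := by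
  refine ⟨fun V _ G h => ?_, 7, hexagonCone, isKTree_hexagonCone, not_oddColorable_hexagonCone⟩
  classical
  have := Fintype.ofFinite V
  obtain ⟨𝒯, h𝒯⟩ := h.exists_solvable
  exact h𝒯.oddColorable
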